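/- Consider the totally asymmetric simple exclusion process (TASEP) on $\{0,1,2,\dots\}$ with an open boundary at $0$ where particles are only injected: the state is the finite set of occupied sites; each particle jumps at rate $1$ one step to the right if that site is vacant; and a particle is injected at site $0$ at rate $\alpha\ge 0$ if site $0$ is vacant (no particle is ejected). Let $\mathcal P_n(t)$ be the probability that, starting with no particles at time $0$, there are exactly $n$ particles at time $t\ge 0$. Then, for every $\alpha\ge0$, \[\mathcal P_0(t)=e^{-\alpha t},\] and, for every $\alpha\ge 0$ with $\alpha\ne1$, \[\mathcal P_1(t)=\frac{\alpha}{1-\alpha}\left(t-\frac{\alpha}{1-\alpha}\right)e^{-\alpha t}+\frac{\alpha^2}{(1-\alpha)^2}e^{-t},\] \[\mathcal P_2(t)=\left(\frac{\alpha^2}{2(1-\alpha)^2}t^2-\frac{\alpha^2}{(1-\alpha)^3}t+\frac{\alpha^2}{(1-\alpha)^2}\right)e^{-\alpha t} +\left(\frac{\alpha^2}{2(1-\alpha)^2}t^2-\frac{\alpha(1-3\alpha+\alpha^2)}{(1-\alpha)^3}t+\frac{1-2\alpha}{(1-\alpha)^2}\right)e^{-t}-e^{-(1+\alpha)t}.\]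 For $\alpha=1$ and $n=1,2$, the probability $\mathcal P_n(t)$ is the limit, as $\alpha\to1$, $\alpha\neq 1$, of $\mathcal P_n(t)$ for rate $\alpha$, that is, of the expressions above. -/

import Mathlib

open scoped NNReal ENNReal Topology

noncomputable section

namespace OpenTASEP

/-- A configuration of finitely many particles on `{0, 1, 2, …}`: the finite set of occupied
sites. -/
abbrev Config := Finset ℕ

/-- The sites whose particle can jump: the occupied sites `i` such that `i + 1` is vacant. -/
def movable (x : Config) : Finset ℕ := {i ∈ x | i + 1 ∉ x}

/-- The configuration after the particle at `i` has jumped to `i + 1`. -/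
def hop (x : Config) (i : ℕ) : Config := insert (i + 1) (x.erase i)

/-- The configuration after a particle has been injected at `0`. -/
def inject (x : Config) : Config := insert 0 x

/-- The total rate of leaving `x`: injection has rate `α` if the site `0` is vacant, and each
particle whose right neighbour site is vacant jumps to it at rate `1`. There are no other moves. -/
def exitRate (α : ℝ≥0) (x : Config) : ℝ≥0 :=
  (if 0 ∈ x then 0 else α) + (movable x).card

/-- The sum of `f z` over the configurations `z` that can be reached from `x` by one move,
each weighted with the rate of the move `x → z`. The Markov generator of the process is
`f ↦ (x ↦ moveSum α f x - exitRate α x * f x)`. -/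
def moveSum (α : ℝ≥0) (f : Config → ℝ≥0∞) (x : Config) : ℝ≥0∞ :=
  (if 0 ∈ x then 0 else (α : ℝ≥0∞) * f (inject x)) + ∑ i ∈ movable x, f (hop x i)

/-- The probability that the process started from `x` makes exactly `k` moves up to time `t`
and is then in the configuration `y`: the time of the first move is exponential with parameter
`exitRate α x`, the move is chosen with probability proportional to its rate, and
the process starts afresh after it. -/
def transitionWithMoves (α : ℝ≥0) : ℕ → ℝ → Config → Config → ℝ≥0∞
  | 0, t, x, y => if x = y then ENNReal.ofReal (Real.exp (-(exitRate α x * t))) else 0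
  | k + 1, t, x, y =>
      ∫⁻ u in Set.Icc 0 t, ENNReal.ofReal (Real.exp (-(exitRate α x * u))) *
        moveSum α (fun z => transitionWithMoves α k (t - u) z y) x

/-- The transition function of the process: the probability to be in `y` at time `t` when
started from `x`. -/
def transition (α : ℝ≥0) (t : ℝ) (x y : Config) : ℝ≥0∞ :=
  ∑' k : ℕ, transitionWithMoves α k t x y

/-- The probability that, starting with no particles at time `0`, there are exactly `n` particles
at time `t`. -/
def particleProb (α : ℝ≥0) (n : ℕ) (t : ℝ) : ℝ :=
  (∑' y : {y : Config // y.card = n}, transition α t ∅ y).toReal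

theorem measurable_transitionWithMoves (α : ℝ≥0) (k : ℕ) (x y : Config) :
    Measurable (fun t => transitionWithMoves α k t x y) := by
  induction k generalizing x with
  | zero =>
    simp only [transitionWithMoves]
    split_ifs
    · fun_prop
    · fun_prop
  | succ k ih =>
    simp only [transitionWithMoves]
    have key : Measurable (fun p : ℝ × ℝ =>
        (Set.Icc 0 p.1).indicator (fun u => ENNReal.ofReal (Real.exp (-(exitRate α x * u))) *
          moveSum α (fun z => transitionWithMoves α k (p.1 - u) z y) x) p.2) := by
      have hs : MeasurableSet {p : ℝ × ℝ | 0 ≤ p.2 ∧ p.2 ≤ p.1} :=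
        (measurableSet_le measurable_const measurable_snd).inter
          (measurableSet_le measurable_snd measurable_fst)
      have hm : ∀ z, Measurable fun p : ℝ × ℝ => transitionWithMoves α k (p.1 - p.2) z y :=
        fun z => (ih z).comp (measurable_fst.sub measurable_snd)
      have : Measurable (fun p : ℝ × ℝ => ENNReal.ofReal (Real.exp (-(exitRate α x * p.2))) *
          moveSum α (fun z => transitionWithMoves α k (p.1 - p.2) z y) x) := by
        refine Measurable.mul (by fun_prop) ?_
        unfold moveSum
        refine Measurable.add ?_ (Finset.measurable_sum _ fun i _ => hm _)
        split_ifs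
        · exact measurable_const
        · exact (hm _).const_mul _
      exact this.indicator hs
    have := key.lintegral_prod_right' (ν := MeasureTheory.volume)
    simpa only [MeasureTheory.lintegral_indicator measurableSet_Icc] using this

theorem lintegral_exp_mul_le (l t : ℝ) (ht : 0 ≤ t) (hl : 0 ≤ l) :
    ENNReal.ofReal (Real.exp (-(l * t))) +
      ∫⁻ u in Set.Icc 0 t, ENNReal.ofReal (Real.exp (-(l * u))) * ENNReal.ofReal l ≤ 1 := by
  have hint : ∫ u in (0 : ℝ)..t, Real.exp (-(l * u)) * l = 1 - Real.exp (-(l * t)) := by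
    have hd : ∀ u ∈ Set.uIcc 0 t,
        HasDerivAt (fun u => -Real.exp (-(l * u))) (Real.exp (-(l * u)) * l) u := by
      intro u _
      have h1 : HasDerivAt (fun u : ℝ => -(l * u)) (-(l * 1)) u :=
        ((hasDerivAt_id u).const_mul l).neg
      have h2 := h1.exp.neg
      rwa [mul_one, mul_neg, neg_neg] at h2
    rw [intervalIntegral.integral_eq_sub_of_hasDerivAt hd
      (Continuous.intervalIntegrable (by fun_prop) _ _)]
    simp
    ring
  have hle : Real.exp (-(l * t)) ≤ 1 := Real.exp_le_one_iff.2 (by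
    have := mul_nonneg hl ht
    linarith)
  have h2 : ∫⁻ u in Set.Icc 0 t, ENNReal.ofReal (Real.exp (-(l * u))) * ENNReal.ofReal l
      = ENNReal.ofReal (1 - Real.exp (-(l * t))) := by
    rw [← hint, intervalIntegral.integral_of_le ht, ← MeasureTheory.integral_Icc_eq_integral_Ioc,
      MeasureTheory.ofReal_integral_eq_lintegral_ofReal]
    · refine MeasureTheory.lintegral_congr fun u => ?_
      rw [ENNReal.ofReal_mul (Real.exp_nonneg _)]
    · exact (Continuous.integrableOn_Icc (by fun_prop))
    · exact Filter.Eventually.of_forall fun u => mul_nonneg (Real.exp_nonneg _) hl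
  rw [h2, ← ENNReal.ofReal_add (Real.exp_nonneg _) (by linarith)]
  simp

theorem sum_transitionWithMoves_le_one (α : ℝ≥0) (K : ℕ) (s : Finset Config) (t : ℝ) (ht : 0 ≤ t)
    (x : Config) :
    ∑ k ∈ Finset.range K, ∑ y ∈ s, transitionWithMoves α k t x y ≤ 1 := by
  induction K generalizing t x with
  | zero => simp
  | succ K ih =>
    rw [Finset.sum_range_succ', add_comm]
    refine le_trans (add_le_add ?_ ?_) (lintegral_exp_mul_le (exitRate α x) t ht (by positivity))
    · simp only [transitionWithMoves]
      rw [Finset.sum_ite_eq]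
      split_ifs <;> simp
    · have hm : ∀ k y z, Measurable fun u => transitionWithMoves α k (t - u) z y := fun k y z =>
        (measurable_transitionWithMoves α k z y).comp (measurable_const.sub measurable_id)
      have hmm : ∀ k y, Measurable fun u => ENNReal.ofReal (Real.exp (-(exitRate α x * u))) *
          moveSum α (fun z => transitionWithMoves α k (t - u) z y) x := by
        intro k y
        refine Measurable.mul (by fun_prop) ?_
        unfold moveSum
        refine Measurable.add ?_ (Finset.measurable_sum _ fun i _ => hm _ _ _)
        split_ifs
        · exact measurable_const
        · exact (hm _ _ _).const_mul _
      simp only [transitionWithMoves]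
      simp_rw [← MeasureTheory.lintegral_finsetSum s fun y _ => hmm _ y]
      rw [← MeasureTheory.lintegral_finsetSum _
        fun k _ => Finset.measurable_sum _ fun y _ => hmm k y]
      refine MeasureTheory.setLIntegral_mono' measurableSet_Icc fun u hu => ?_
      simp_rw [← Finset.mul_sum]
      refine mul_le_mul_right ?_ _
      have ih' := fun z => ih (t - u) (by linarith [hu.2]) z
      have hcard : ENNReal.ofReal (exitRate α x : ℝ) =
          (if 0 ∈ x then 0 else (α : ℝ≥0∞)) + ∑ i ∈ movable x, (1 : ℝ≥0∞) := by
        rw [ENNReal.ofReal_coe_nnreal, exitRate]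
        split_ifs <;> simp
      rw [hcard]
      simp only [moveSum, Finset.sum_add_distrib]
      refine add_le_add ?_ ?_
      · split_ifs
        · simp
        · simp_rw [← Finset.mul_sum]
          exact le_trans (mul_le_mul_right (ih' _) _) (by simp)
      · have : ∑ k ∈ Finset.range K, ∑ y ∈ s, ∑ i ∈ movable x,
            transitionWithMoves α k (t - u) (hop x i) y =
            ∑ i ∈ movable x, ∑ k ∈ Finset.range K, ∑ y ∈ s,
              transitionWithMoves α k (t - u) (hop x i) y := by
          rw [Finset.sum_comm]
          rw [Finset.sum_congr rfl fun y _ => Finset.sum_comm, Finset.sum_comm]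
          exact Finset.sum_congr rfl fun i _ => Finset.sum_comm
        rw [this]
        exact Finset.sum_le_sum fun i _ => ih' _

/-- The transition probabilities have total mass at most `1`, so the value of `particleProb` is
a true (finite) sum of probabilities. -/
theorem tsum_transition_le_one (α : ℝ≥0) (t : ℝ) (ht : 0 ≤ t) (x : Config) :
    ∑' y, transition α t x y ≤ 1 := by
  unfold transition
  rw [ENNReal.tsum_comm]
  refine ENNReal.summable.tsum_le_of_sum_range_le fun K => ?_
  rw [← Summable.tsum_finsetSum fun _ _ => ENNReal.summable]
  refine ENNReal.summable.tsum_le_of_sum_le fun s => ?_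
  rw [Finset.sum_comm]
  exact sum_transitionWithMoves_le_one α K s t ht x

end OpenTASEP

end

/-!
Particles are never removed, so among the configurations with at most `n` particles the exit rates
are bounded by `α + n`, and the probability of having exactly `n` particles at time `t`, as a
function of the initial configuration, is the only locally bounded solution of Kolmogorov's
backward equation that starts at the indicator of `n` particles and vanishes above `n` particles
(`particleProb_eq_of_backward`). Uniqueness comes from a contraction: conditioning on the first
move shrinks the distance to any such solution by the probability of a move before time `T`
(`abs_sub_truncProb_le`).

For `n ≤ 2` a solution need only depend on the number of particles and on the occupation of the
sites `0` and `1`: the next injection has to wait only for the site `0` to become vacant, a particle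
at `0` is held up only by a particle at `1`, and once two particles have left `0` it is irrelevant
for the count up to two where they are. The backward equation therefore reduces to a triangular system of linear equations `g' = h - c g`, solved successively by
Duhamel's formula `relax` (`particleProb_zero`, `particleProb_one`, `particleProb_two`).

The Duhamel solutions are jointly continuous in the rate and the time, also at rate one, which
gives the limits `α → 1`. For `α ≠ 1` they are combinations of `exp (-α t)`, `exp (-t)` and
`exp (-(1 + α) t)` with polynomial coefficients, identified by uniqueness for the linear equation
(`eq_relax`).
-/

namespace OpenTASEP

open MeasureTheory Set

/-! ### Moves and the generator -/

/-- The real-valued version of `moveSum`. -/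
noncomputable def realMoveSum (α : ℝ≥0) (f : Config → ℝ) (x : Config) : ℝ :=
  (if 0 ∈ x then 0 else (α : ℝ) * f (inject x)) + ∑ i ∈ movable x, f (hop x i)

theorem card_hop {x : Config} {i : ℕ} (hi : i ∈ movable x) : (hop x i).card = x.card := by
  simp only [movable, Finset.mem_filter] at hi
  rw [hop, Finset.card_insert_of_notMem (fun h => hi.2 (Finset.mem_of_mem_erase h)),
    Finset.card_erase_add_one hi.1]

theorem card_inject {x : Config} (h : 0 ∉ x) : (inject x).card = x.card + 1 :=
  Finset.card_insert_of_notMem h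

theorem exitRate_le (α : ℝ≥0) {n : ℕ} {x : Config} (hx : x.card ≤ n) :
    (exitRate α x : ℝ) ≤ α + n := by
  have h1 : ((movable x).card : ℝ) ≤ n := by
    exact_mod_cast (Finset.card_filter_le _ _).trans hx
  have h2 : (0 : ℝ) ≤ α := α.2
  unfold exitRate
  split_ifs <;> push_cast <;> linarith

theorem toReal_moveSum (α : ℝ≥0) {f : Config → ℝ≥0∞} (hf : ∀ z, f z ≠ ∞) (x : Config) :
    (moveSum α f x).toReal = realMoveSum α (fun z => (f z).toReal) x := by
  unfold moveSum realMoveSum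
  rw [ENNReal.toReal_add, ENNReal.toReal_sum fun i _ => hf _]
  · split_ifs <;> simp
  · split_ifs
    · simp
    · exact ENNReal.mul_ne_top ENNReal.coe_ne_top (hf _)
  · exact ENNReal.sum_ne_top.2 fun i _ => hf _

theorem moveSum_ne_top (α : ℝ≥0) {f : Config → ℝ≥0∞} (hf : ∀ z, f z ≠ ∞) (x : Config) :
    moveSum α f x ≠ ∞ := by
  unfold moveSum
  refine ENNReal.add_ne_top.2 ⟨?_, ENNReal.sum_ne_top.2 fun i _ => hf _⟩
  split_ifs
  · simp
  · exact ENNReal.mul_ne_top ENNReal.coe_ne_top (hf _)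

theorem realMoveSum_sub (α : ℝ≥0) (f g : Config → ℝ) (x : Config) :
    realMoveSum α f x - realMoveSum α g x = realMoveSum α (fun z => f z - g z) x := by
  unfold realMoveSum
  rw [Finset.sum_sub_distrib]
  split_ifs <;> ring

theorem abs_realMoveSum_le (α : ℝ≥0) {f : Config → ℝ} {C : ℝ} (hf : ∀ z, |f z| ≤ C)
    (x : Config) : |realMoveSum α f x| ≤ exitRate α x * C := by
  unfold realMoveSum exitRate
  push_cast
  rw [add_mul]
  refine (abs_add_le _ _).trans (add_le_add ?_ ?_)
  · split_ifs
    · simp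
    · rw [abs_mul, abs_of_nonneg (NNReal.coe_nonneg α)]
      exact mul_le_mul_of_nonneg_left (hf _) α.2
  · refine (Finset.abs_sum_le_sum_abs _ _).trans ?_
    simpa using Finset.sum_le_card_nsmul (movable x) (fun i => |f (hop x i)|) C fun i _ => hf _

/-! ### Truncation by the number of moves -/

/-- The probability that the process started from `x` makes fewer than `K` moves up to time `t`
and then has exactly `n` particles. -/
noncomputable def truncProb (α : ℝ≥0) (n K : ℕ) (t : ℝ) (x : Config) : ℝ≥0∞ :=
  ∑ k ∈ Finset.range K, ∑' y : {y : Config // y.card = n}, transitionWithMoves α k t x y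

theorem measurable_truncProb (α : ℝ≥0) (n K : ℕ) (x : Config) :
    Measurable fun t => truncProb α n K t x :=
  Finset.measurable_sum _ fun _ _ =>
    Measurable.tsum fun _ => measurable_transitionWithMoves _ _ _ _

theorem measurable_moveSum (α : ℝ≥0) {f : ℝ → Config → ℝ≥0∞}
    (hf : ∀ z, Measurable fun t => f t z) (x : Config) :
    Measurable fun t => moveSum α (f t) x := by
  unfold moveSum
  refine Measurable.add ?_ (Finset.measurable_sum _ fun i _ => hf _)
  split_ifs
  · exact measurable_const
  · exact (hf _).const_mul _

theorem truncProb_zero (α : ℝ≥0) (n : ℕ) (t : ℝ) (x : Config) : truncProb α n 0 t x = 0 := by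
  simp [truncProb]

theorem moveSum_sum (α : ℝ≥0) {ι : Type*} (s : Finset ι) (f : ι → Config → ℝ≥0∞) (x : Config) :
    ∑ k ∈ s, moveSum α (f k) x = moveSum α (fun z => ∑ k ∈ s, f k z) x := by
  unfold moveSum
  rw [Finset.sum_add_distrib, Finset.sum_comm]
  split_ifs
  · simp
  · rw [Finset.mul_sum]

theorem moveSum_tsum (α : ℝ≥0) {ι : Type*} (f : ι → Config → ℝ≥0∞) (x : Config) :
    ∑' k, moveSum α (f k) x = moveSum α (fun z => ∑' k, f k z) x := by
  unfold moveSum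
  rw [ENNReal.tsum_add, Summable.tsum_finsetSum fun _ _ => ENNReal.summable]
  split_ifs
  · simp
  · rw [ENNReal.tsum_mul_left]

/-- First-step decomposition: conditioning on the time and the kind of the first move. -/
theorem truncProb_succ (α : ℝ≥0) (n K : ℕ) (t : ℝ) (x : Config) :
    truncProb α n (K + 1) t x =
      (if x.card = n then ENNReal.ofReal (Real.exp (-(exitRate α x * t))) else 0) +
        ∫⁻ u in Icc 0 t, ENNReal.ofReal (Real.exp (-(exitRate α x * u))) *
          moveSum α (fun z => truncProb α n K (t - u) z) x := by
  have hm : ∀ k y, Measurable fun u => ENNReal.ofReal (Real.exp (-(exitRate α x * u))) *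
      moveSum α (fun z => transitionWithMoves α k (t - u) z y) x := fun k y =>
    Measurable.mul (by fun_prop) (measurable_moveSum α (fun z =>
      (measurable_transitionWithMoves α k z y).comp (measurable_const.sub measurable_id)) x)
  rw [truncProb, Finset.sum_range_succ', add_comm]
  congr 1
  · simp only [transitionWithMoves]
    split_ifs with h
    · rw [tsum_eq_single (⟨x, h⟩ : {y : Config // y.card = n})]
      · simp
      · rintro ⟨y, hy⟩ hne
        rw [if_neg]
        rintro rfl
        exact hne rfl
    · rw [ENNReal.tsum_eq_zero]
      rintro ⟨y, hy⟩
      rw [if_neg]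
      rintro rfl
      exact h hy
  · simp only [transitionWithMoves]
    simp_rw [← lintegral_tsum fun y : {y : Config // y.card = n} => (hm _ y).aemeasurable]
    rw [← lintegral_finsetSum _ fun k _ =>
      Measurable.tsum fun y : {y : Config // y.card = n} => hm k y]
    refine lintegral_congr fun u => ?_
    simp_rw [ENNReal.tsum_mul_left, moveSum_tsum]
    rw [← Finset.mul_sum, moveSum_sum]
    rfl

theorem truncProb_le_one (α : ℝ≥0) (n K : ℕ) {t : ℝ} (ht : 0 ≤ t) (x : Config) :
    truncProb α n K t x ≤ 1 := by
  refine le_trans ?_ (tsum_transition_le_one α t ht x)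
  rw [truncProb, ← Summable.tsum_finsetSum fun _ _ => ENNReal.summable]
  refine (ENNReal.tsum_le_tsum fun y => ENNReal.sum_le_tsum _).trans ?_
  exact ENNReal.tsum_comp_le_tsum_of_injective Subtype.val_injective fun y => transition α t x y

/-- No particle ever leaves, so a configuration with more than `n` particles never has `n`. -/
theorem truncProb_eq_zero (α : ℝ≥0) {n : ℕ} (K : ℕ) (t : ℝ) {x : Config} (hx : n < x.card) :
    truncProb α n K t x = 0 := by
  induction K generalizing t x with
  | zero => exact truncProb_zero _ _ _ _
  | succ K ih =>
    have h : ∀ u, moveSum α (fun z => truncProb α n K (t - u) z) x = 0 := by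
      intro u
      unfold moveSum
      rw [Finset.sum_eq_zero fun i hi => ih _ (by rwa [card_hop hi]), add_zero]
      split_ifs with h0
      · rfl
      · exact mul_eq_zero_of_right _ (ih _ (by rw [card_inject h0]; omega))
    rw [truncProb_succ, if_neg hx.ne']
    simp [h]

theorem toReal_truncProb_succ (α : ℝ≥0) (n K : ℕ) {t : ℝ} (ht : 0 ≤ t) (x : Config) :
    (truncProb α n (K + 1) t x).toReal =
      (if x.card = n then Real.exp (-(exitRate α x * t)) else 0) +
        ∫ u in Icc 0 t, Real.exp (-(exitRate α x * u)) *
          realMoveSum α (fun z => (truncProb α n K (t - u) z).toReal) x := by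
  have hfin : ∀ K : ℕ, ∀ s : ℝ, 0 ≤ s → ∀ z, truncProb α n K s z ≠ ∞ := fun K s hs z =>
    ((truncProb_le_one α n K hs z).trans_lt ENNReal.one_lt_top).ne
  have h := hfin (K + 1) t ht x
  have hmeas : Measurable fun u => ENNReal.ofReal (Real.exp (-(exitRate α x * u))) *
      moveSum α (fun z => truncProb α n K (t - u) z) x :=
    Measurable.mul (by fun_prop) (measurable_moveSum α (fun z =>
      (measurable_truncProb α n K z).comp (measurable_const.sub measurable_id)) x)
  rw [truncProb_succ] at h ⊢
  rw [ENNReal.toReal_add (ENNReal.add_ne_top.1 h).1 (ENNReal.add_ne_top.1 h).2]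
  congr 1
  · split_ifs
    · rw [ENNReal.toReal_ofReal (Real.exp_nonneg _)]
    · rfl
  · rw [← integral_toReal hmeas.aemeasurable]
    · refine setIntegral_congr_fun measurableSet_Icc fun u hu => ?_
      rw [ENNReal.toReal_mul, ENNReal.toReal_ofReal (Real.exp_nonneg _),
        toReal_moveSum α fun z => hfin K _ (by linarith [hu.2]) z]
    · filter_upwards [ae_restrict_mem measurableSet_Icc] with u hu
      exact ENNReal.mul_lt_top ENNReal.ofReal_lt_top
        (moveSum_ne_top α (fun z => hfin K _ (by linarith [hu.2]) z) x).lt_top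

theorem tendsto_toReal_truncProb (α : ℝ≥0) (n : ℕ) {t : ℝ} (ht : 0 ≤ t) :
    Filter.Tendsto (fun K => (truncProb α n K t ∅).toReal) Filter.atTop
      (𝓝 (particleProb α n t)) := by
  have hle : ∑' y : {y : Config // y.card = n}, transition α t ∅ y ≤ 1 :=
    (ENNReal.tsum_comp_le_tsum_of_injective Subtype.val_injective
      fun y => transition α t ∅ y).trans (tsum_transition_le_one α t ht ∅)
  refine (ENNReal.tendsto_toReal (hle.trans_lt ENNReal.one_lt_top).ne).comp ?_
  unfold transition
  rw [ENNReal.tsum_comm]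
  exact ENNReal.tendsto_nat_tsum _

/-! ### Uniqueness for the backward equation -/

theorem continuous_realMoveSum (α : ℝ≥0) {f : ℝ → Config → ℝ}
    (hf : ∀ z, Continuous fun t => f t z) (x : Config) :
    Continuous fun t => realMoveSum α (f t) x := by
  unfold realMoveSum
  refine Continuous.add ?_ (continuous_finsetSum _ fun i _ => hf _)
  split_ifs
  · exact continuous_const
  · exact (hf _).const_mul _

theorem integral_Icc_exp_mul (l : ℝ) {t : ℝ} (ht : 0 ≤ t) :
    ∫ u in Icc 0 t, Real.exp (-(l * u)) * l = 1 - Real.exp (-(l * t)) := by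
  rw [integral_Icc_eq_integral_Ioc, ← intervalIntegral.integral_of_le ht]
  have hd : ∀ u ∈ uIcc 0 t,
      HasDerivAt (fun u => -Real.exp (-(l * u))) (Real.exp (-(l * u)) * l) u := by
    intro u _
    have h1 : HasDerivAt (fun u : ℝ => -(l * u)) (-(l * 1)) u :=
      ((hasDerivAt_id u).const_mul l).neg
    exact h1.exp.neg.congr_deriv (by ring)
  rw [intervalIntegral.integral_eq_sub_of_hasDerivAt hd
    (Continuous.intervalIntegrable (by fun_prop) _ _)]
  simp
  ring

/-- The integrated form of the backward equation `∂ₜ G = L G`, where `L` is the generator. -/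
theorem backward_integral (α : ℝ≥0) {G : ℝ → Config → ℝ}
    (hG : ∀ t x, HasDerivAt (fun s => G s x)
      (realMoveSum α (G t) x - exitRate α x * G t x) t) {t : ℝ} (ht : 0 ≤ t) (x : Config) :
    G t x = Real.exp (-(exitRate α x * t)) * G 0 x +
      ∫ u in Icc 0 t, Real.exp (-(exitRate α x * u)) * realMoveSum α (G (t - u)) x := by
  have hc : ∀ z, Continuous fun s => G s z := fun z =>
    continuous_iff_continuousAt.2 fun s => (hG s z).continuousAt
  rw [integral_Icc_eq_integral_Ioc, ← intervalIntegral.integral_of_le ht]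
  have hd : ∀ u ∈ uIcc 0 t,
      HasDerivAt (fun u => -(Real.exp (-(exitRate α x * u)) * G (t - u) x))
        (Real.exp (-(exitRate α x * u)) * realMoveSum α (G (t - u)) x) u := by
    intro u _
    have h1 : HasDerivAt (fun u : ℝ => -((exitRate α x : ℝ) * u)) (-((exitRate α x : ℝ) * 1)) u :=
      ((hasDerivAt_id u).const_mul (exitRate α x : ℝ)).neg
    have h2 : HasDerivAt (fun u : ℝ => t - u) (-1) u := by
      simpa using (hasDerivAt_id u).const_sub t
    have h3 := (h1.exp.mul ((hG (t - u) x).comp u h2)).neg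
    refine h3.congr_deriv ?_
    simp only [Function.comp]
    ring
  rw [intervalIntegral.integral_eq_sub_of_hasDerivAt hd]
  · simp
  · refine Continuous.intervalIntegrable (Continuous.mul (by fun_prop) ?_) _ _
    exact continuous_realMoveSum α (f := fun u => G (t - u))
      (fun z => (hc z).comp (continuous_const.sub continuous_id)) x

/-- On configurations with at most `n` particles all exit rates are at most `α + n`, so the
first-step map contracts the distance to a solution `G` of the backward equation by the
probability `1 - exp (-(α + n) T)` of a move before time `T`. -/
theorem abs_sub_truncProb_le (α : ℝ≥0) (n : ℕ) {G : ℝ → Config → ℝ} {T C : ℝ}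
    (hzero : ∀ t x, n < x.card → G t x = 0)
    (hinit : ∀ x, G 0 x = if x.card = n then 1 else 0)
    (hG : ∀ t x, HasDerivAt (fun s => G s x)
      (realMoveSum α (G t) x - exitRate α x * G t x) t)
    (hC : ∀ t ∈ Icc 0 T, ∀ x, |G t x| ≤ C) (K : ℕ) :
    ∀ t ∈ Icc 0 T, ∀ x, |G t x - (truncProb α n K t x).toReal| ≤
      (1 - Real.exp (-((α + n) * T))) ^ K * C := by
  induction K with
  | zero => simpa [truncProb_zero] using hC
  | succ K ih =>
    intro t ht x
    have hc : ∀ z, Continuous fun s => G s z := fun z =>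
      continuous_iff_continuousAt.2 fun s => (hG s z).continuousAt
    set q : ℝ := 1 - Real.exp (-((α + n) * T)) with hq
    have hT : 0 ≤ T := ht.1.trans ht.2
    have hC0 : 0 ≤ C := (abs_nonneg _).trans (hC t ht x)
    have hq0 : 0 ≤ q := by
      have : Real.exp (-((α + n) * T)) ≤ 1 := Real.exp_le_one_iff.2 (by
        have : 0 ≤ (α + n : ℝ) * T := by positivity
        linarith)
      linarith
    rcases lt_or_ge n x.card with hx | hx
    · rw [hzero t x hx, truncProb_eq_zero α _ _ hx]
      simpa using mul_nonneg (pow_nonneg hq0 _) hC0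
    set r : ℝ := (exitRate α x : ℝ) with hr
    have hr0 : 0 ≤ r := (exitRate α x).2
    have hi1 : IntegrableOn (fun u => Real.exp (-(r * u)) * realMoveSum α (G (t - u)) x)
        (Icc 0 t) :=
      (Continuous.mul (by fun_prop) (continuous_realMoveSum α (f := fun u => G (t - u))
        (fun z => (hc z).comp (continuous_const.sub continuous_id)) x)).integrableOn_Icc
    have hi2 : IntegrableOn (fun u => Real.exp (-(r * u)) *
        realMoveSum α (fun z => (truncProb α n K (t - u) z).toReal) x) (Icc 0 t) := by
      refine Measure.integrableOn_of_bounded (M := r) (by simp) ?_ ?_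
      · refine Measurable.aestronglyMeasurable (Measurable.mul (by fun_prop) ?_)
        have hm : ∀ z, Measurable fun u => (truncProb α n K (t - u) z).toReal := fun z =>
          ((measurable_truncProb α n K z).comp (measurable_const.sub measurable_id)).ennreal_toReal
        unfold realMoveSum
        refine Measurable.add ?_ (Finset.measurable_sum _ fun i _ => hm _)
        split_ifs
        · exact measurable_const
        · exact (hm _).const_mul _
      · filter_upwards [ae_restrict_mem measurableSet_Icc] with u hu
        have h1 : Real.exp (-(r * u)) ≤ 1 := Real.exp_le_one_iff.2 (by
          have := mul_nonneg hr0 hu.1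
          linarith)
        have hone : ∀ z, |(truncProb α n K (t - u) z).toReal| ≤ 1 := fun z => by
          rw [abs_of_nonneg ENNReal.toReal_nonneg]
          exact ENNReal.toReal_le_of_le_ofReal zero_le_one
            (by simpa using truncProb_le_one α n K (by linarith [hu.2]) z)
        rw [Real.norm_eq_abs, abs_mul, abs_of_nonneg (Real.exp_nonneg _)]
        refine (mul_le_mul h1 (abs_realMoveSum_le α hone x) (abs_nonneg _) zero_le_one).trans ?_
        simp [hr]
    have hdiff : G t x - (truncProb α n (K + 1) t x).toReal =
        ∫ u in Icc 0 t, Real.exp (-(r * u)) *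
          realMoveSum α (fun z => G (t - u) z - (truncProb α n K (t - u) z).toReal) x := by
      rw [backward_integral α hG ht.1 x, toReal_truncProb_succ α n K ht.1 x, hinit]
      simp only [← realMoveSum_sub, mul_sub]
      rw [integral_sub hi1 hi2]
      split_ifs <;> ring
    rw [hdiff, ← Real.norm_eq_abs]
    have hdom : ∀ u ∈ Icc 0 t, ‖Real.exp (-(r * u)) *
          realMoveSum α (fun z => G (t - u) z - (truncProb α n K (t - u) z).toReal) x‖ ≤
        Real.exp (-(r * u)) * r * (q ^ K * C) := by
      intro u hu
      rw [Real.norm_eq_abs, abs_mul, abs_of_nonneg (Real.exp_nonneg _), mul_assoc]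
      refine mul_le_mul_of_nonneg_left (abs_realMoveSum_le α (fun z => ?_) x) (Real.exp_nonneg _)
      exact ih _ ⟨by linarith [hu.2], by linarith [hu.1, ht.2]⟩ z
    refine (norm_integral_le_of_norm_le (g := fun u => Real.exp (-(r * u)) * r * (q ^ K * C))
      (Continuous.integrableOn_Icc (by fun_prop)) ?_).trans ?_
    · filter_upwards [ae_restrict_mem measurableSet_Icc] with u hu using hdom u hu
    · rw [integral_mul_const, integral_Icc_exp_mul r ht.1, pow_succ', mul_assoc]
      refine mul_le_mul_of_nonneg_right ?_ (mul_nonneg (pow_nonneg hq0 _) hC0)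
      have : r * t ≤ (α + n) * T :=
        mul_le_mul (exitRate_le α hx) ht.2 ht.1 (by positivity)
      have := Real.exp_le_exp.2 (neg_le_neg this)
      linarith

/-- The probability of `n` particles is given by every locally bounded solution of the backward
equation with the right initial values that vanishes above `n` particles. -/
theorem particleProb_eq_of_backward (α : ℝ≥0) (n : ℕ) {G : ℝ → Config → ℝ}
    (hzero : ∀ t x, n < x.card → G t x = 0)
    (hinit : ∀ x, G 0 x = if x.card = n then 1 else 0)
    (hG : ∀ t x, HasDerivAt (fun s => G s x)
      (realMoveSum α (G t) x - exitRate α x * G t x) t)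
    (hbdd : ∀ T, ∃ C, ∀ t ∈ Icc 0 T, ∀ x, |G t x| ≤ C) {t : ℝ} (ht : 0 ≤ t) :
    particleProb α n t = G t ∅ := by
  obtain ⟨C, hC⟩ := hbdd t
  refine tendsto_nhds_unique (tendsto_toReal_truncProb α n ht) ?_
  have hq : Filter.Tendsto (fun K : ℕ => (1 - Real.exp (-((α + n) * t))) ^ K * C)
      Filter.atTop (𝓝 0) := by
    have h0 : Real.exp (-((α + n) * t)) ≤ 1 := Real.exp_le_one_iff.2 (by
      have : 0 ≤ (α + n : ℝ) * t := by positivity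
      linarith)
    have h1 := Real.exp_pos (-((α + n) * t))
    simpa using (tendsto_pow_atTop_nhds_zero_of_lt_one (by linarith)
      (by linarith : 1 - Real.exp (-((α + n) * t)) < 1)).mul_const C
  refine tendsto_iff_norm_sub_tendsto_zero.2 (squeeze_zero (fun _ => norm_nonneg _)
    (fun K => ?_) hq)
  rw [norm_sub_rev, Real.norm_eq_abs]
  exact abs_sub_truncProb_le α n hzero hinit hG hC K t ⟨ht, le_rfl⟩ ∅

/-! ### Linear equations with constant coefficient -/

/-- The solution `g` of the linear equation `g' = h - c g` with `g 0 = v`, in Duhamel's form. -/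
noncomputable def relax (c v : ℝ) (h : ℝ → ℝ) (t : ℝ) : ℝ :=
  Real.exp (-(c * t)) * (v + ∫ s in (0 : ℝ)..t, Real.exp (c * s) * h s)

theorem relax_zero (c v : ℝ) (h : ℝ → ℝ) : relax c v h 0 = v := by
  simp [relax]

theorem hasDerivAt_exp_mul (a t : ℝ) :
    HasDerivAt (fun s : ℝ => Real.exp (a * s)) (a * Real.exp (a * t)) t := by
  have h1 : HasDerivAt (fun s : ℝ => a * s) (a * 1) t := (hasDerivAt_id t).const_mul a
  exact h1.exp.congr_deriv (by ring)

theorem hasDerivAt_exp_neg_mul (a t : ℝ) :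
    HasDerivAt (fun s : ℝ => Real.exp (-(a * s))) (-a * Real.exp (-(a * t))) t := by
  simpa only [neg_mul] using hasDerivAt_exp_mul (-a) t

theorem hasDerivAt_relax (c v : ℝ) {h : ℝ → ℝ} (hh : Continuous h) (t : ℝ) :
    HasDerivAt (relax c v h) (h t - c * relax c v h t) t := by
  have hc : Continuous fun s => Real.exp (c * s) * h s := by fun_prop
  have h2 : HasDerivAt (fun t => v + ∫ s in (0 : ℝ)..t, Real.exp (c * s) * h s)
      (Real.exp (c * t) * h t) t :=
    (intervalIntegral.integral_hasDerivAt_right (hc.intervalIntegrable _ _)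
      (hc.stronglyMeasurableAtFilter _ _) hc.continuousAt).const_add v
  refine ((hasDerivAt_exp_neg_mul c t).mul h2).congr_deriv ?_
  have he : Real.exp (-(c * t)) * Real.exp (c * t) = 1 := by
    rw [← Real.exp_add]
    simp
  rw [relax, ← mul_assoc, he]
  ring

theorem eq_relax {c v : ℝ} {f h : ℝ → ℝ} (hh : Continuous h) (h0 : f 0 = v)
    (hf : ∀ t, HasDerivAt f (h t - c * f t) t) (t : ℝ) : relax c v h t = f t := by
  have hd : ∀ s ∈ uIcc 0 t,
      HasDerivAt (fun s => Real.exp (c * s) * f s) (Real.exp (c * s) * h s) s := fun s _ =>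
    ((hasDerivAt_exp_mul c s).mul (hf s)).congr_deriv (by ring)
  have he : Real.exp (-(c * t)) * Real.exp (c * t) = 1 := by
    rw [← Real.exp_add]
    simp
  rw [relax, intervalIntegral.integral_eq_sub_of_hasDerivAt hd
    (Continuous.intervalIntegrable (by fun_prop) _ _), mul_zero, Real.exp_zero, one_mul, h0,
    add_sub_cancel, ← mul_assoc, he, one_mul]

theorem continuous_relax {c v : ℝ → ℝ} {h : ℝ → ℝ → ℝ} (hc : Continuous c) (hv : Continuous v)
    (hh : Continuous fun p : ℝ × ℝ => h p.1 p.2) :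
    Continuous fun p : ℝ × ℝ => relax (c p.1) (v p.1) (h p.1) p.2 := by
  unfold relax
  refine Continuous.mul (by fun_prop) (Continuous.add (by fun_prop) ?_)
  refine intervalIntegral.continuous_parametric_intervalIntegral_of_continuous
    (f := fun (p : ℝ × ℝ) s => Real.exp (c p.1 * s) * h p.1 s) ?_ continuous_snd
  have : Continuous fun q : (ℝ × ℝ) × ℝ => h q.1.1 q.2 :=
    hh.comp (f := fun q : (ℝ × ℝ) × ℝ => (q.1.1, q.2)) (by fun_prop)
  exact Continuous.mul (by fun_prop) this

/-! ### The lumped process -/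

/-- The probability that no particle is injected up to time `t` while the site `0` stays
vacant. -/
noncomputable def vacantProb (a t : ℝ) : ℝ := Real.exp (-(a * t))

/-- The probability of no injection up to time `t` when the site `0` is occupied and its particle
is free to jump. -/
noncomputable def occupiedProb (a : ℝ) : ℝ → ℝ := relax 1 1 (vacantProb a)

/-- The probability of no injection up to time `t` from the configuration `{0, 1}`. -/
noncomputable def blockedProb (a : ℝ) : ℝ → ℝ := relax 1 1 (occupiedProb a)

/-- The probability of exactly one injection up to time `t` when the site `0` is vacant and the
injected particle will find the site `1` vacant for ever. -/
noncomputable def farProb (a : ℝ) : ℝ → ℝ := relax a 0 fun t => a * occupiedProb a t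

/-- The probability of exactly one injection up to time `t` from the configuration `{1}`. -/
noncomputable def nearProb (a : ℝ) : ℝ → ℝ :=
  relax (1 + a) 0 fun t => a * blockedProb a t + farProb a t

/-- The probability of exactly one injection up to time `t` from the configuration `{0}`. -/
noncomputable def originProb (a : ℝ) : ℝ → ℝ := relax 1 0 (nearProb a)

/-- The probability of exactly two injections up to time `t` from the empty configuration. -/
noncomputable def emptyProb (a : ℝ) : ℝ → ℝ := relax a 0 fun t => a * originProb a t

theorem continuous_vacantProb : Continuous fun p : ℝ × ℝ => vacantProb p.1 p.2 := by
  unfold vacantProb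
  fun_prop

theorem continuous_occupiedProb : Continuous fun p : ℝ × ℝ => occupiedProb p.1 p.2 :=
  continuous_relax continuous_const continuous_const continuous_vacantProb

theorem continuous_blockedProb : Continuous fun p : ℝ × ℝ => blockedProb p.1 p.2 :=
  continuous_relax continuous_const continuous_const continuous_occupiedProb

theorem continuous_farProb : Continuous fun p : ℝ × ℝ => farProb p.1 p.2 :=
  continuous_relax (h := fun a t => a * occupiedProb a t) continuous_id continuous_const
    (continuous_fst.mul continuous_occupiedProb)

theorem continuous_nearProb : Continuous fun p : ℝ × ℝ => nearProb p.1 p.2 :=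
  continuous_relax (c := fun a => 1 + a) (h := fun a t => a * blockedProb a t + farProb a t)
    (by fun_prop) continuous_const
    ((continuous_fst.mul continuous_blockedProb).add continuous_farProb)

theorem continuous_originProb : Continuous fun p : ℝ × ℝ => originProb p.1 p.2 :=
  continuous_relax continuous_const continuous_const continuous_nearProb

theorem continuous_emptyProb : Continuous fun p : ℝ × ℝ => emptyProb p.1 p.2 :=
  continuous_relax (h := fun a t => a * originProb a t) continuous_id continuous_const
    (continuous_fst.mul continuous_originProb)

/-- Fixing the injection rate in a jointly continuous family. -/
theorem continuous_right {f : ℝ → ℝ → ℝ} (hf : Continuous fun p : ℝ × ℝ => f p.1 p.2) (a : ℝ) :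
    Continuous (f a) :=
  hf.comp (f := fun t => (a, t)) (by fun_prop)

theorem hasDerivAt_vacantProb (a t : ℝ) :
    HasDerivAt (vacantProb a) (-a * vacantProb a t) t :=
  hasDerivAt_exp_neg_mul a t

theorem hasDerivAt_occupiedProb (a t : ℝ) :
    HasDerivAt (occupiedProb a) (vacantProb a t - 1 * occupiedProb a t) t :=
  hasDerivAt_relax _ _ (continuous_right continuous_vacantProb a) t

theorem hasDerivAt_blockedProb (a t : ℝ) :
    HasDerivAt (blockedProb a) (occupiedProb a t - 1 * blockedProb a t) t :=
  hasDerivAt_relax _ _ (continuous_right continuous_occupiedProb a) t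

theorem hasDerivAt_farProb (a t : ℝ) :
    HasDerivAt (farProb a) (a * occupiedProb a t - a * farProb a t) t :=
  hasDerivAt_relax _ _ ((continuous_right continuous_occupiedProb a).const_mul a) t

theorem hasDerivAt_nearProb (a t : ℝ) :
    HasDerivAt (nearProb a) (a * blockedProb a t + farProb a t - (1 + a) * nearProb a t) t :=
  hasDerivAt_relax _ _ (((continuous_right continuous_blockedProb a).const_mul a).add
    (continuous_right continuous_farProb a)) t

theorem hasDerivAt_originProb (a t : ℝ) :
    HasDerivAt (originProb a) (nearProb a t - 1 * originProb a t) t :=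
  hasDerivAt_relax _ _ (continuous_right continuous_nearProb a) t

theorem hasDerivAt_emptyProb (a t : ℝ) :
    HasDerivAt (emptyProb a) (a * originProb a t - a * emptyProb a t) t :=
  hasDerivAt_relax _ _ ((continuous_right continuous_originProb a).const_mul a) t

/-! ### Solutions of the backward equation -/

theorem zero_mem_hop {x : Config} {i : ℕ} : 0 ∈ hop x i ↔ 0 ∈ x ∧ i ≠ 0 := by
  simp [hop, and_comm, eq_comm]

theorem realMoveSum_empty (α : ℝ≥0) (f : Config → ℝ) : realMoveSum α f ∅ = α * f {0} := by
  simp [realMoveSum, movable, inject]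

theorem exitRate_empty (α : ℝ≥0) : exitRate α ∅ = α := by
  simp [exitRate, movable]

theorem movable_singleton (i : ℕ) : movable {i} = {i} := by
  simp [movable, Finset.filter_singleton]

theorem hop_singleton (i : ℕ) : hop {i} i = {i + 1} := by
  simp [hop]

/-- The generator when the site `0` is vacant and no jump of a particle changes `f`. -/
theorem generator_of_hop_const (α : ℝ≥0) {f : Config → ℝ} {x : Config} (h0 : 0 ∉ x)
    (hf : ∀ i ∈ movable x, f (hop x i) = f x) :
    realMoveSum α f x - exitRate α x * f x = α * f (inject x) - α * f x := by
  rw [realMoveSum, Finset.sum_congr rfl hf, exitRate, if_neg h0, if_neg h0]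
  simp
  ring

theorem zero_notMem_hop {x : Config} (h0 : 0 ∉ x) (i : ℕ) : 0 ∉ hop x i := fun h =>
  h0 (zero_mem_hop.1 h).1

/-- The probability of no particles at time `t`, as a function of the initial configuration. -/
noncomputable def backwardZero (a t : ℝ) (x : Config) : ℝ :=
  if x.card = 0 then vacantProb a t else 0

/-- The probability of exactly one particle at time `t`, as a function of the initial
configuration. -/
noncomputable def backwardOne (a t : ℝ) (x : Config) : ℝ :=
  if x.card = 0 then farProb a t
  else if x.card = 1 then if 0 ∈ x then occupiedProb a t else vacantProb a t
  else 0

/-- The probability of exactly two particles at time `t`, as a function of the initial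
configuration. -/
noncomputable def backwardTwo (a t : ℝ) (x : Config) : ℝ :=
  if x.card = 0 then emptyProb a t
  else if x.card = 1 then
    if 0 ∈ x then originProb a t else if 1 ∈ x then nearProb a t else farProb a t
  else if x.card = 2 then
    if 0 ∈ x then if 1 ∈ x then blockedProb a t else occupiedProb a t else vacantProb a t
  else 0

/-- Functions that vanish above `n` particles solve the backward equation there trivially. -/
theorem generator_eq_zero (α : ℝ≥0) {n : ℕ} {f : Config → ℝ}
    (hf : ∀ x : Config, n < x.card → f x = 0) {x : Config} (hx : n < x.card) :
    realMoveSum α f x - exitRate α x * f x = 0 := by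
  rw [realMoveSum, hf x hx, Finset.sum_eq_zero fun i hi => hf _ (by rwa [card_hop hi])]
  split_ifs with h0
  · simp
  · rw [hf _ (by rw [card_inject h0]; omega)]
    simp

theorem exists_bound {f : ℝ → ℝ} (hf : Continuous f) (T : ℝ) : ∃ C, ∀ t ∈ Icc 0 T, |f t| ≤ C :=
  isCompact_Icc.exists_bound_of_continuousOn hf.continuousOn

theorem particleProb_zero (α : ℝ≥0) {t : ℝ} (ht : 0 ≤ t) :
    particleProb α 0 t = vacantProb α t := by
  have hz : ∀ t (x : Config), 0 < x.card → backwardZero α t x = 0 := fun t x hx => by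
    simp [backwardZero, hx.ne']
  rw [particleProb_eq_of_backward α 0 (G := backwardZero α) hz ?_ ?_ ?_ ht]
  · simp [backwardZero]
  · intro x
    simp [backwardZero, vacantProb]
  · intro t x
    rcases Nat.eq_zero_or_pos x.card with hx | hx
    · obtain rfl := Finset.card_eq_zero.1 hx
      rw [realMoveSum_empty, exitRate_empty]
      simpa [backwardZero] using hasDerivAt_vacantProb α t
    · rw [generator_eq_zero α (hz t) hx]
      simp only [hz _ x hx]
      exact hasDerivAt_const _ _
  · intro T
    obtain ⟨C, hC⟩ := exists_bound (continuous_right continuous_vacantProb α) T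
    refine ⟨|C|, fun t ht x => ?_⟩
    unfold backwardZero
    split_ifs
    · exact (hC t ht).trans (le_abs_self C)
    · simp

theorem particleProb_one (α : ℝ≥0) {t : ℝ} (ht : 0 ≤ t) :
    particleProb α 1 t = farProb α t := by
  have hz : ∀ t (x : Config), 1 < x.card → backwardOne α t x = 0 := fun t x hx => by
    rw [backwardOne, if_neg (by omega), if_neg (by omega)]
  rw [particleProb_eq_of_backward α 1 (G := backwardOne α) hz ?_ ?_ ?_ ht]
  · simp [backwardOne]
  · intro x
    by_cases h0 : x.card = 0
    · simp [backwardOne, h0, farProb, relax_zero]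
    · simp [backwardOne, h0, occupiedProb, relax_zero, vacantProb]
  · intro t x
    rcases lt_or_ge 1 x.card with hx | hx
    · rw [generator_eq_zero α (hz t) hx]
      simp only [hz _ x hx]
      exact hasDerivAt_const _ _
    rcases hx.lt_or_eq with hx | hx
    · obtain rfl : x = ∅ := Finset.card_eq_zero.1 (by omega)
      rw [realMoveSum_empty, exitRate_empty]
      simpa [backwardOne] using hasDerivAt_farProb α t
    · obtain ⟨i, rfl⟩ := Finset.card_eq_one.1 hx
      rcases Nat.eq_zero_or_pos i with rfl | hi
      · simpa [backwardOne, realMoveSum, exitRate, movable_singleton, hop_singleton] using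
          hasDerivAt_occupiedProb α t
      · have h0 : (0 : ℕ) ∉ ({i} : Config) := by simp; omega
        rw [generator_of_hop_const α h0 fun j hj => by
          simp [backwardOne, card_hop hj, zero_notMem_hop h0 j, h0]]
        rw [hz t _ (by rw [card_inject h0]; simp)]
        simpa [backwardOne, hi.ne] using hasDerivAt_vacantProb α t
  · intro T
    obtain ⟨C₁, h₁⟩ := exists_bound (continuous_right continuous_vacantProb α) T
    obtain ⟨C₂, h₂⟩ := exists_bound (continuous_right continuous_occupiedProb α) T
    obtain ⟨C₃, h₃⟩ := exists_bound (continuous_right continuous_farProb α) T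
    refine ⟨|C₁| + |C₂| + |C₃|, fun t ht x => ?_⟩
    have := h₁ t ht
    have := h₂ t ht
    have := h₃ t ht
    have := le_abs_self C₁
    have := le_abs_self C₂
    have := le_abs_self C₃
    have := abs_nonneg C₁
    have := abs_nonneg C₂
    have := abs_nonneg C₃
    unfold backwardOne
    split_ifs <;> first | linarith | (rw [abs_zero]; linarith)

/-- A configuration with two particles, one of them at `0`. -/
theorem eq_pair_of_card_eq_two {x : Config} (hx : x.card = 2) (h0 : 0 ∈ x) :
    ∃ j, 0 < j ∧ x = {0, j} := by
  obtain ⟨j, hj⟩ := Finset.card_eq_one.1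
    (show (x.erase 0).card = 1 by rw [Finset.card_erase_of_mem h0, hx])
  refine ⟨j, Nat.pos_of_ne_zero fun h => ?_, by rw [← hj, Finset.insert_erase h0]⟩
  have : j ∈ x.erase 0 := by simp [hj]
  exact (Finset.mem_erase.1 this).1 h

theorem movable_zero_one : movable {0, 1} = {1} := by
  decide

theorem movable_pair {j : ℕ} (hj : 1 < j) : movable {0, j} = {0, j} := by
  ext i
  simp only [movable, Finset.mem_filter, Finset.mem_insert, Finset.mem_singleton]
  omega

theorem particleProb_two (α : ℝ≥0) {t : ℝ} (ht : 0 ≤ t) :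
    particleProb α 2 t = emptyProb α t := by
  have hz : ∀ t (x : Config), 2 < x.card → backwardTwo α t x = 0 := fun t x hx => by
    rw [backwardTwo, if_neg (by omega), if_neg (by omega), if_neg (by omega)]
  rw [particleProb_eq_of_backward α 2 (G := backwardTwo α) hz ?_ ?_ ?_ ht]
  · simp [backwardTwo]
  · intro x
    by_cases h0 : x.card = 0
    · simp [backwardTwo, h0, emptyProb, relax_zero]
    by_cases h1 : x.card = 1
    · simp [backwardTwo, h1, originProb, nearProb, farProb, relax_zero]
    · simp [backwardTwo, h0, h1, blockedProb, occupiedProb, relax_zero, vacantProb]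
  · intro t x
    rcases lt_or_ge 2 x.card with hx | hx
    · rw [generator_eq_zero α (hz t) hx]
      simp only [hz _ x hx]
      exact hasDerivAt_const _ _
    obtain hx | hx | hx : x.card = 0 ∨ x.card = 1 ∨ x.card = 2 := by omega
    · obtain rfl : x = ∅ := Finset.card_eq_zero.1 hx
      rw [realMoveSum_empty, exitRate_empty]
      simpa [backwardTwo] using hasDerivAt_emptyProb α t
    · obtain ⟨i, rfl⟩ := Finset.card_eq_one.1 hx
      obtain rfl | rfl | hi : i = 0 ∨ i = 1 ∨ 1 < i := by omega
      · simpa [backwardTwo, realMoveSum, exitRate, movable_singleton, hop_singleton] using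
          hasDerivAt_originProb α t
      · simpa [backwardTwo, realMoveSum, exitRate, movable_singleton, hop_singleton, inject,
          add_comm] using hasDerivAt_nearProb α t
      · have h0 : (0 : ℕ) ∉ ({i} : Config) := by simp; omega
        rw [generator_of_hop_const α h0 fun j hj => by
          obtain rfl : j = i := by simpa [movable_singleton] using hj
          simp [backwardTwo, hop_singleton, show 0 ≠ j by omega, show 1 ≠ j by omega,
            show j ≠ 0 by omega]]
        have hc : (inject {i}).card = 2 := by rw [card_inject h0]; simp
        have h1 : 1 ∉ inject {i} := by simp [inject]; omega
        have h0' : 0 ∈ inject {i} := by simp [inject]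
        simpa [backwardTwo, hc, h1, h0', show 0 ≠ i by omega, show 1 ≠ i by omega] using
          hasDerivAt_farProb α t
    · by_cases h0 : 0 ∈ x
      · obtain ⟨j, hj, rfl⟩ := eq_pair_of_card_eq_two hx h0
        rcases Nat.lt_or_eq_of_le hj with hj1 | rfl
        · have hc0 : (hop {0, j} 0).card = 2 := by
            rw [card_hop (by simp [movable_pair hj1]), hx]
          have hcj : (hop {0, j} j).card = 2 := by
            rw [card_hop (by simp [movable_pair hj1]), hx]
          have h00 : 0 ∉ hop {0, j} 0 := by simp [zero_mem_hop]
          have h0j : 0 ∈ hop {0, j} j := zero_mem_hop.2 ⟨h0, by omega⟩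
          have h1j : 1 ∉ hop {0, j} j := by simp [hop]; omega
          have h1 : 1 ≠ j := by omega
          have hd := hasDerivAt_occupiedProb α t
          simp only [backwardTwo, hx, realMoveSum, exitRate, movable_pair hj1]
          rw [Finset.sum_pair (by omega : 0 ≠ j)]
          simp [hc0, hcj, h00, h0j, h1j, h1]
          exact hd.congr_deriv (by ring)
        · have hh : hop {0, 1} 1 = {0, 2} := by decide
          simpa [backwardTwo, realMoveSum, exitRate, movable_zero_one, hh] using
            hasDerivAt_blockedProb α t
      · rw [generator_of_hop_const α h0 fun j hj => by
          simp [backwardTwo, card_hop hj, hx, zero_notMem_hop h0 j, h0]]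
        rw [hz t _ (by rw [card_inject h0]; omega)]
        simpa [backwardTwo, hx, h0] using hasDerivAt_vacantProb α t
  · intro T
    obtain ⟨C₁, h₁⟩ := exists_bound (continuous_right continuous_vacantProb α) T
    obtain ⟨C₂, h₂⟩ := exists_bound (continuous_right continuous_occupiedProb α) T
    obtain ⟨C₃, h₃⟩ := exists_bound (continuous_right continuous_blockedProb α) T
    obtain ⟨C₄, h₄⟩ := exists_bound (continuous_right continuous_farProb α) T
    obtain ⟨C₅, h₅⟩ := exists_bound (continuous_right continuous_nearProb α) T
    obtain ⟨C₆, h₆⟩ := exists_bound (continuous_right continuous_originProb α) T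
    obtain ⟨C₇, h₇⟩ := exists_bound (continuous_right continuous_emptyProb α) T
    refine ⟨max 0 (max C₁ (max C₂ (max C₃ (max C₄ (max C₅ (max C₆ C₇)))))), fun t ht x => ?_⟩
    have := h₁ t ht
    have := h₂ t ht
    have := h₃ t ht
    have := h₄ t ht
    have := h₅ t ht
    have := h₆ t ht
    have := h₇ t ht
    unfold backwardTwo
    split_ifs <;> simp [*]

/-! ### Closed forms for rates other than one -/

/-- All closed forms below are sums of terms of this shape, and are written with their zero
coefficients so that this lemma differentiates them term by term. -/
theorem hasDerivAt_quadratic_mul_exp (p q r a t : ℝ) :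
    HasDerivAt (fun s : ℝ => (p + q * s + r * s ^ 2) * Real.exp (-(a * s)))
      ((q + 2 * r * t - a * (p + q * t + r * t ^ 2)) * Real.exp (-(a * t))) t := by
  have h1 : HasDerivAt (fun s : ℝ => p + q * s + r * s ^ 2) (q * 1 + r * (2 * t)) t := by
    have h2 : HasDerivAt (fun s : ℝ => p + q * s) (q * 1) t :=
      ((hasDerivAt_id t).const_mul q).const_add p
    have h3 : HasDerivAt (fun s : ℝ => r * s ^ 2) (r * (2 * t)) t := by
      simpa using (hasDerivAt_pow 2 t).const_mul r
    exact h2.add h3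
  exact (h1.mul (hasDerivAt_exp_neg_mul a t)).congr_deriv (by ring)

theorem occupiedProb_eq {a : ℝ} (ha : 1 - a ≠ 0) (t : ℝ) :
    occupiedProb a t = (1 / (1 - a) + 0 * t + 0 * t ^ 2) * Real.exp (-(a * t)) +
      (-a / (1 - a) + 0 * t + 0 * t ^ 2) * Real.exp (-(1 * t)) := by
  refine eq_relax (f := fun t => (1 / (1 - a) + 0 * t + 0 * t ^ 2) * Real.exp (-(a * t)) +
      (-a / (1 - a) + 0 * t + 0 * t ^ 2) * Real.exp (-(1 * t)))
    (continuous_right continuous_vacantProb a) ?_ (fun t => ?_) t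
  · simp
    field_simp
    ring
  · refine ((hasDerivAt_quadratic_mul_exp _ _ _ a t).add
      (hasDerivAt_quadratic_mul_exp _ _ _ 1 t)).congr_deriv ?_
    rw [vacantProb]
    field_simp
    ring

theorem blockedProb_eq {a : ℝ} (ha : 1 - a ≠ 0) (t : ℝ) :
    blockedProb a t = (1 / (1 - a) ^ 2 + 0 * t + 0 * t ^ 2) * Real.exp (-(a * t)) +
      (1 - 1 / (1 - a) ^ 2 + -a / (1 - a) * t + 0 * t ^ 2) * Real.exp (-(1 * t)) := by
  refine eq_relax (f := fun t => (1 / (1 - a) ^ 2 + 0 * t + 0 * t ^ 2) * Real.exp (-(a * t)) +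
      (1 - 1 / (1 - a) ^ 2 + -a / (1 - a) * t + 0 * t ^ 2) * Real.exp (-(1 * t)))
    (continuous_right continuous_occupiedProb a) ?_ (fun t => ?_) t
  · simp
  · refine ((hasDerivAt_quadratic_mul_exp _ _ _ a t).add
      (hasDerivAt_quadratic_mul_exp _ _ _ 1 t)).congr_deriv ?_
    rw [occupiedProb_eq ha]
    field_simp
    ring

theorem farProb_eq {a : ℝ} (ha : 1 - a ≠ 0) (t : ℝ) :
    farProb a t =
      (-(a ^ 2 / (1 - a) ^ 2) + a / (1 - a) * t + 0 * t ^ 2) * Real.exp (-(a * t)) +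
        (a ^ 2 / (1 - a) ^ 2 + 0 * t + 0 * t ^ 2) * Real.exp (-(1 * t)) := by
  refine eq_relax (f := fun t =>
      (-(a ^ 2 / (1 - a) ^ 2) + a / (1 - a) * t + 0 * t ^ 2) * Real.exp (-(a * t)) +
        (a ^ 2 / (1 - a) ^ 2 + 0 * t + 0 * t ^ 2) * Real.exp (-(1 * t)))
    ((continuous_right continuous_occupiedProb a).const_mul a) ?_ (fun t => ?_) t
  · simp
  · refine ((hasDerivAt_quadratic_mul_exp _ _ _ a t).add
      (hasDerivAt_quadratic_mul_exp _ _ _ 1 t)).congr_deriv ?_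
    rw [occupiedProb_eq ha]
    field_simp
    ring

theorem nearProb_eq {a : ℝ} (ha : 1 - a ≠ 0) (t : ℝ) :
    nearProb a t = (0 + a / (1 - a) * t + 0 * t ^ 2) * Real.exp (-(a * t)) +
      (1 + -a / (1 - a) * t + 0 * t ^ 2) * Real.exp (-(1 * t)) +
      (-1 + 0 * t + 0 * t ^ 2) * Real.exp (-((1 + a) * t)) := by
  refine eq_relax (f := fun t => (0 + a / (1 - a) * t + 0 * t ^ 2) * Real.exp (-(a * t)) +
      (1 + -a / (1 - a) * t + 0 * t ^ 2) * Real.exp (-(1 * t)) +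
      (-1 + 0 * t + 0 * t ^ 2) * Real.exp (-((1 + a) * t)))
    (h := fun t => a * blockedProb a t + farProb a t)
    (((continuous_right continuous_blockedProb a).const_mul a).add
      (continuous_right continuous_farProb a)) ?_ (fun t => ?_) t
  · simp
  · refine (((hasDerivAt_quadratic_mul_exp _ _ _ a t).add
      (hasDerivAt_quadratic_mul_exp _ _ _ 1 t)).add
      (hasDerivAt_quadratic_mul_exp _ _ _ (1 + a) t)).congr_deriv ?_
    rw [blockedProb_eq ha, farProb_eq ha]
    field_simp
    ring

theorem originProb_eq {a : ℝ} (ha : 1 - a ≠ 0) (ha0 : a ≠ 0) (t : ℝ) :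
    originProb a t =
      (-(a / (1 - a) ^ 3) + a / (1 - a) ^ 2 * t + 0 * t ^ 2) * Real.exp (-(a * t)) +
      (a / (1 - a) ^ 3 - 1 / a + 1 * t + -a / (2 * (1 - a)) * t ^ 2) * Real.exp (-(1 * t)) +
      (1 / a + 0 * t + 0 * t ^ 2) * Real.exp (-((1 + a) * t)) := by
  refine eq_relax (f := fun t =>
      (-(a / (1 - a) ^ 3) + a / (1 - a) ^ 2 * t + 0 * t ^ 2) * Real.exp (-(a * t)) +
      (a / (1 - a) ^ 3 - 1 / a + 1 * t + -a / (2 * (1 - a)) * t ^ 2) * Real.exp (-(1 * t)) +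
      (1 / a + 0 * t + 0 * t ^ 2) * Real.exp (-((1 + a) * t)))
    (continuous_right continuous_nearProb a) ?_ (fun t => ?_) t
  · simp
    ring
  · refine (((hasDerivAt_quadratic_mul_exp _ _ _ a t).add
      (hasDerivAt_quadratic_mul_exp _ _ _ 1 t)).add
      (hasDerivAt_quadratic_mul_exp _ _ _ (1 + a) t)).congr_deriv ?_
    rw [nearProb_eq ha]
    field_simp
    ring

theorem emptyProb_eq_of_ne_zero {a : ℝ} (ha : 1 - a ≠ 0) (ha0 : a ≠ 0) (t : ℝ) :
    emptyProb a t =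
      (a ^ 2 / (1 - a) ^ 2 + -(a ^ 2 / (1 - a) ^ 3) * t + a ^ 2 / (2 * (1 - a) ^ 2) * t ^ 2) *
        Real.exp (-(a * t)) +
      ((1 - 2 * a) / (1 - a) ^ 2 + -(a * (1 - 3 * a + a ^ 2) / (1 - a) ^ 3) * t +
        a ^ 2 / (2 * (1 - a) ^ 2) * t ^ 2) * Real.exp (-(1 * t)) +
      (-1 + 0 * t + 0 * t ^ 2) * Real.exp (-((1 + a) * t)) := by
  refine eq_relax (f := fun t =>
      (a ^ 2 / (1 - a) ^ 2 + -(a ^ 2 / (1 - a) ^ 3) * t + a ^ 2 / (2 * (1 - a) ^ 2) * t ^ 2) *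
        Real.exp (-(a * t)) +
      ((1 - 2 * a) / (1 - a) ^ 2 + -(a * (1 - 3 * a + a ^ 2) / (1 - a) ^ 3) * t +
        a ^ 2 / (2 * (1 - a) ^ 2) * t ^ 2) * Real.exp (-(1 * t)) +
      (-1 + 0 * t + 0 * t ^ 2) * Real.exp (-((1 + a) * t)))
    ((continuous_right continuous_originProb a).const_mul a) ?_ (fun t => ?_) t
  · simp
    field_simp
    ring
  · refine (((hasDerivAt_quadratic_mul_exp _ _ _ a t).add
      (hasDerivAt_quadratic_mul_exp _ _ _ 1 t)).add
      (hasDerivAt_quadratic_mul_exp _ _ _ (1 + a) t)).congr_deriv ?_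
    rw [originProb_eq ha ha0]
    field_simp
    ring

/-- At rate zero no particle is ever injected. -/
theorem emptyProb_zero (t : ℝ) : emptyProb 0 t = 0 := by
  simp [emptyProb, relax]

end OpenTASEP

theorem mainTheorem11 (t : ℝ) (ht : 0 ≤ t) :
    (∀ α : ℝ≥0, OpenTASEP.particleProb α 0 t = Real.exp (-(α * t))) ∧
    (∀ α : ℝ≥0, α ≠ 1 →
      OpenTASEP.particleProb α 1 t =
        (α : ℝ) / (1 - α) * (t - α / (1 - α)) * Real.exp (-(α * t))
          + (α : ℝ) ^ 2 / (1 - α) ^ 2 * Real.exp (-t)) ∧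
    (∀ α : ℝ≥0, α ≠ 1 →
      OpenTASEP.particleProb α 2 t =
        ((α : ℝ) ^ 2 / (2 * (1 - α) ^ 2) * t ^ 2 - (α : ℝ) ^ 2 / (1 - α) ^ 3 * t
            + (α : ℝ) ^ 2 / (1 - α) ^ 2) * Real.exp (-(α * t))
          + ((α : ℝ) ^ 2 / (2 * (1 - α) ^ 2) * t ^ 2
              - (α : ℝ) * (1 - 3 * α + (α : ℝ) ^ 2) / (1 - α) ^ 3 * t
              + (1 - 2 * (α : ℝ)) / (1 - α) ^ 2) * Real.exp (-t)
          - Real.exp (-((1 + α) * t))) ∧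
    (Filter.Tendsto (fun α : ℝ≥0 => OpenTASEP.particleProb α 1 t) (𝓝[≠] 1)
        (𝓝 (OpenTASEP.particleProb 1 1 t)) ∧
      Filter.Tendsto (fun α : ℝ≥0 => OpenTASEP.particleProb α 2 t) (𝓝[≠] 1)
        (𝓝 (OpenTASEP.particleProb 1 2 t))) := by
  have hne : ∀ α : ℝ≥0, α ≠ 1 → (1 - α : ℝ) ≠ 0 := fun α hα h =>
    hα (NNReal.coe_injective (sub_eq_zero.1 h).symm)
  refine ⟨fun α => OpenTASEP.particleProb_zero α ht, fun α hα => ?_, fun α hα => ?_, ?_, ?_⟩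
  · rw [OpenTASEP.particleProb_one α ht, OpenTASEP.farProb_eq (hne α hα), one_mul]
    have := hne α hα
    field_simp
    ring
  · rw [OpenTASEP.particleProb_two α ht]
    rcases eq_or_ne (α : ℝ) 0 with h0 | h0
    · -- the term `1 / α` in the closed form of `originProb` excludes rate zero
      rw [h0, OpenTASEP.emptyProb_zero]
      simp
    · rw [OpenTASEP.emptyProb_eq_of_ne_zero (hne α hα) h0, one_mul]
      ring
  · simp only [OpenTASEP.particleProb_one _ ht]
    exact ((OpenTASEP.continuous_farProb.comp (f := fun α : ℝ≥0 => ((α : ℝ), t))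
      (by fun_prop)).tendsto 1).mono_left nhdsWithin_le_nhds
  · simp only [OpenTASEP.particleProb_two _ ht]
    exact ((OpenTASEP.continuous_emptyProb.comp (f := fun α : ℝ≥0 => ((α : ℝ), t))
      (by fun_prop)).tendsto 1).mono_left nhdsWithin_le_nhds
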